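/- Let $\mathbb{K}$ be $\mathbb{R}$ or $\mathbb{C}$, and let $\mathbb{N}=\{1,2,3,\ldots\}$. A \emph{Schreier set} is a finite set $F\subset\mathbb{N}$ with $F=\emptyset$ or $|F|\le\min F$. A \emph{Schreier chain} is a non-empty finite collection $\mathcal{C}=\{F_1,\ldots,F_m\}$ of non-empty Schreier sets with $\max F_j<\min F_{j+1}$ for $1\le j<m$. For $1<p<\infty$, the \emph{Baernstein space} $B_p$ is the Banach space of all sequences $x\in\mathbb{K}^{\mathbb{N}}$ such that \[ \|x\|_{B_p}=\sup_{\mathcal{C}}\Bigl(\sum_{F\in\mathcal{C}}\Bigl(\sum_{n\in F}|x(n)|\Bigr)^p\Bigr)^{1/p}<\infty, \] where the supremum is over all Schreier chains $\mathcal{C}$. A bounded linear operator is \emph{strictly singular} if none of its restrictions to an infinite-dimensional subspace is an isomorphic embedding. For every pair $p,q\in(1,\infty)$, there is a strictly singular, non-compact bounded linear operator $T\colon B_p\to B_q$. Moreover, $T$ can be chosen of the form $T=VR$, where $R\colon B_p\to\ell_q$ is the formal inclusion $R(x)=x$ (which is well defined and bounded), and $V\colon\ell_q\to B_q$ is a bounded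 linear operator that embeds $\ell_q$ complementably in $B_q$, in the sense that $UV=I_{\ell_q}$ for some bounded linear operator $U\colon B_q\to\ell_q$. In particular, when $q<p$, it is not true that every bounded linear operator from $B_p$ to $B_q$ is compact. -/

import Mathlib

open scoped ENNReal

/-- A Schreier set: a finite set `F` of positive integers which is empty or satisfies
`|F| ≤ min F`; that is, `|F| ≤ n` for every `n ∈ F`. -/
def IsSchreierSet (F : Finset ℕ+) : Prop :=
  ∀ n ∈ F, F.card ≤ (n : ℕ)

/-- A Schreier chain: a non-empty finite collection of non-empty, consecutive Schreier sets.
Consecutive means that any two distinct members `F`, `G` satisfy `max F < min G` or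
`max G < min F`. -/
structure IsSchreierChain (C : Finset (Finset ℕ+)) : Prop where
  nonempty : C.Nonempty
  nonempty_of_mem : ∀ F ∈ C, F.Nonempty
  isSchreierSet_of_mem : ∀ F ∈ C, IsSchreierSet F
  consecutive : ∀ F ∈ C, ∀ G ∈ C, F ≠ G →
    (∀ m ∈ F, ∀ n ∈ G, m < n) ∨ (∀ m ∈ F, ∀ n ∈ G, n < m)

section Baernstein

variable {𝕜 : Type*} [RCLike 𝕜]

/-- The quantity `β_p(x, C) = (∑_{F ∈ C} (∑_{n ∈ F} |x n|) ^ p) ^ (1/p)`. -/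
noncomputable def baernsteinBeta (p : ℝ) (x : ℕ+ → 𝕜) (C : Finset (Finset ℕ+)) : ℝ≥0∞ :=
  (∑ F ∈ C, (∑ n ∈ F, ‖x n‖ₑ) ^ p) ^ (1 / p)

/-- The `[0, ∞]`-valued Baernstein norm of a scalar sequence: the supremum of `β_p(x, C)` over
all Schreier chains `C`. -/
noncomputable def baernsteinENorm (p : ℝ) (x : ℕ+ → 𝕜) : ℝ≥0∞ :=
  ⨆ (C : Finset (Finset ℕ+)) (_ : IsSchreierChain C), baernsteinBeta p x C

theorem baernsteinBeta_le_eNorm (p : ℝ) (x : ℕ+ → 𝕜) {C : Finset (Finset ℕ+)}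
    (hC : IsSchreierChain C) : baernsteinBeta p x C ≤ baernsteinENorm p x :=
  le_iSup₂_of_le C hC le_rfl

theorem baernsteinENorm_add_le {p : ℝ} (hp : 1 < p) (x y : ℕ+ → 𝕜) :
    baernsteinENorm p (x + y) ≤ baernsteinENorm p x + baernsteinENorm p y := by
  refine iSup₂_le fun C hC => ?_
  have h : baernsteinBeta p (x + y) C ≤ baernsteinBeta p x C + baernsteinBeta p y C := by
    refine le_trans ?_ (ENNReal.Lp_add_le C (fun F => ∑ n ∈ F, ‖x n‖ₑ)
      (fun F => ∑ n ∈ F, ‖y n‖ₑ) hp.le)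
    have hp0 : (0 : ℝ) ≤ p := by linarith
    refine ENNReal.rpow_le_rpow (Finset.sum_le_sum fun F _ => ?_) (by positivity)
    refine ENNReal.rpow_le_rpow ?_ hp0
    rw [← Finset.sum_add_distrib]
    exact Finset.sum_le_sum fun n _ => enorm_add_le _ _
  exact h.trans (add_le_add (baernsteinBeta_le_eNorm p x hC) (baernsteinBeta_le_eNorm p y hC))

theorem baernsteinENorm_smul {p : ℝ} (hp : 1 < p) (c : 𝕜) (x : ℕ+ → 𝕜) :
    baernsteinENorm p (c • x) = ‖c‖ₑ * baernsteinENorm p x := by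
  have hp0 : (0 : ℝ) < p := by linarith
  simp only [baernsteinENorm, ENNReal.mul_iSup]
  refine iSup_congr fun C => iSup_congr fun _ => ?_
  simp only [baernsteinBeta, Pi.smul_apply, enorm_smul, ← Finset.mul_sum]
  simp only [ENNReal.mul_rpow_of_nonneg _ _ hp0.le, ← Finset.mul_sum]
  rw [ENNReal.mul_rpow_of_nonneg _ _ (by positivity), ← ENNReal.rpow_mul,
    mul_one_div_cancel hp0.ne', ENNReal.rpow_one]

theorem enorm_le_baernsteinENorm {p : ℝ} (hp : 1 < p) (x : ℕ+ → 𝕜) (n : ℕ+) :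
    ‖x n‖ₑ ≤ baernsteinENorm p x := by
  have hp0 : (0 : ℝ) < p := by linarith
  have hC : IsSchreierChain {{n}} := by
    constructor <;> simp [IsSchreierSet, Nat.one_le_iff_ne_zero]
  refine le_trans (le_of_eq ?_) (baernsteinBeta_le_eNorm p x hC)
  simp [baernsteinBeta, ← ENNReal.rpow_mul, mul_inv_cancel₀ hp0.ne']

variable (𝕜)

/-- The vector space of all scalar sequences of finite Baernstein norm. -/
def baernsteinSubmodule (p : ℝ) [hp : Fact (1 < p)] : Submodule 𝕜 (ℕ+ → 𝕜) where
  carrier := {x | baernsteinENorm p x < ∞}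
  add_mem' {x y} hx hy :=
    (baernsteinENorm_add_le hp.out x y).trans_lt (ENNReal.add_lt_top.2 ⟨hx, hy⟩)
  zero_mem' := by
    have h := baernsteinENorm_smul hp.out (0 : 𝕜) (0 : ℕ+ → 𝕜)
    rw [smul_zero, enorm_zero, zero_mul] at h
    simp [h]
  smul_mem' c x hx := by
    simp only [Set.mem_ofPred_eq, baernsteinENorm_smul hp.out c x] at hx ⊢
    exact ENNReal.mul_lt_top enorm_lt_top hx

/-- The Baernstein space `B_p`, for `1 < p < ∞`. (A type of its own, so that it does not inherit
the topology of coordinatewise convergence.) -/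
def Baernstein (p : ℝ) [Fact (1 < p)] : Type _ := baernsteinSubmodule 𝕜 p

variable {𝕜}

namespace Baernstein

variable {p : ℝ} [hp : Fact (1 < p)]

noncomputable instance : AddCommGroup (Baernstein 𝕜 p) :=
  inferInstanceAs (AddCommGroup (baernsteinSubmodule 𝕜 p))

noncomputable instance : Module 𝕜 (Baernstein 𝕜 p) :=
  inferInstanceAs (Module 𝕜 (baernsteinSubmodule 𝕜 p))

/-- The elements of `B_p` are sequences: `x n` is the `n`-th coordinate of `x`. -/
instance : CoeFun (Baernstein 𝕜 p) (fun _ => ℕ+ → 𝕜) := ⟨fun x => x.1⟩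

noncomputable instance : Norm (Baernstein 𝕜 p) := ⟨fun x => (baernsteinENorm p x.1).toReal⟩

theorem normCore : NormedSpace.Core 𝕜 (Baernstein 𝕜 p) where
  norm_nonneg _ := ENNReal.toReal_nonneg
  norm_smul c x := by
    change (baernsteinENorm p (c • x.1)).toReal = ‖c‖ * (baernsteinENorm p x.1).toReal
    rw [baernsteinENorm_smul hp.out, ENNReal.toReal_mul, toReal_enorm]
  norm_triangle x y := by
    change (baernsteinENorm p (x.1 + y.1)).toReal ≤
      (baernsteinENorm p x.1).toReal + (baernsteinENorm p y.1).toReal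
    have hx : baernsteinENorm p x.1 ≠ ∞ := ne_of_lt x.2
    have hy : baernsteinENorm p y.1 ≠ ∞ := ne_of_lt y.2
    rw [← ENNReal.toReal_add hx hy]
    exact ENNReal.toReal_mono (ENNReal.add_ne_top.2 ⟨hx, hy⟩)
      (baernsteinENorm_add_le hp.out x.1 y.1)
  norm_eq_zero_iff x := by
    constructor
    · intro h
      have hx : baernsteinENorm p x.1 ≠ ∞ := ne_of_lt x.2
      have h0 : baernsteinENorm p x.1 = 0 :=
        ((ENNReal.toReal_eq_zero_iff _).1 h).resolve_right hx
      refine Subtype.ext (funext fun n => ?_)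
      have hn := enorm_le_baernsteinENorm hp.out x.1 n
      rw [h0, nonpos_iff_eq_zero, enorm_eq_zero] at hn
      exact hn
    · rintro rfl
      have h := baernsteinENorm_smul hp.out (0 : 𝕜) (0 : ℕ+ → 𝕜)
      rw [smul_zero, enorm_zero, zero_mul] at h
      change (baernsteinENorm p (0 : ℕ+ → 𝕜)).toReal = 0
      rw [h, ENNReal.toReal_zero]

noncomputable instance : NormedAddCommGroup (Baernstein 𝕜 p) := NormedAddCommGroup.ofCore normCore

noncomputable instance : NormedSpace 𝕜 (Baernstein 𝕜 p) := NormedSpace.ofCore normCore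

end Baernstein

end Baernstein

/-- Makes `lp (fun _ : ℕ+ => 𝕜) (ENNReal.ofReal q)`, that is `ℓ_q`, a normed space for real
`q > 1`. -/
instance fact_one_le_ofReal (q : ℝ) [hq : Fact (1 < q)] : Fact (1 ≤ ENNReal.ofReal q) :=
  ⟨by simpa using hq.out.le⟩

/-- A bounded linear map `T : E → F` is strictly singular if no restriction of `T` to an
infinite-dimensional subspace is an isomorphic embedding (that is, bounded below). -/
def IsStrictlySingular {𝕜 E F : Type*} [RCLike 𝕜] [NormedAddCommGroup E] [NormedSpace 𝕜 E]
    [NormedAddCommGroup F] [NormedSpace 𝕜 F] (T : E →L[𝕜] F) : Prop :=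
  ∀ W : Submodule 𝕜 E, ¬ FiniteDimensional 𝕜 W →
    ¬ ∃ c : ℝ, 0 < c ∧ ∀ x ∈ W, c * ‖x‖ ≤ ‖T x‖

/-! Half of any finite set S forms a Schreier set, so the least |x(n)| over S is at most 2‖x‖/|S|.
Thus the decreasing rearrangement of x ∈ B_p is O(1/n): B_p lies in weak ℓ_1, hence in ℓ_q for every
q > 1, whatever p is. This gives R. It is not compact, because it sends unit vectors to unit
vectors.

R is strictly singular by interpolation. For 1 < r < q, ‖x‖_q^q ≤ ‖x‖_∞^(q-r) ‖x‖_r^r, and ‖x‖_r ≤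
K‖x‖. If R were bounded below on W, the norm of B_p would therefore be bounded on the vectors of W
of bounded sup norm. In an infinite-dimensional W a gliding hump refutes this: it builds vectors of
bounded sup norm that are large on a long Schreier set.

The copy of ℓ_q in B_q is spanned by the averages over the dyadic blocks [2^k, 2^(k+1)), which are
Schreier sets; summation over each block is a left inverse U. Strict singularity passes from R to
VR, and UV = I brings compactness of VR back to R. -/

/-- If every non-empty finite set `S` contains an index `m` with `f m ≤ K / |S|`, then `f` is in
`ℓ_q` for `q > 1`, with a bound depending only on `K` and `q`. -/
theorem sum_rpow_le_of_exists_mul_card_le {ι : Type*} {f : ι → ℝ} (hf : ∀ i, 0 ≤ f i) {K q : ℝ}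
    (hK : 0 ≤ K) (hq : 0 ≤ q) (h : ∀ S : Finset ι, S.Nonempty → ∃ m ∈ S, f m * S.card ≤ K)
    (S : Finset ι) :
    ∑ i ∈ S, f i ^ q ≤ K ^ q * ∑ j ∈ Finset.range S.card, (((j + 1 : ℕ) : ℝ) ^ q)⁻¹ := by
  classical
  induction hn : S.card generalizing S with
  | zero => simp [Finset.card_eq_zero.1 hn]
  | succ n ih =>
    -- Removing such an m from a set of n + 1 elements costs at most (K/(n + 1))^q; no sorting of
    -- the values is needed.
    obtain ⟨m, hm, hmK⟩ := h S (Finset.card_pos.1 (by omega))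
    have hcard : (S.erase m).card = n := by rw [Finset.card_erase_of_mem hm, hn]; rfl
    rw [← Finset.sum_erase_add _ _ hm, Finset.sum_range_succ, mul_add]
    refine add_le_add (ih _ hcard) ?_
    rw [hn] at hmK
    have hpos : (0 : ℝ) < ((n + 1 : ℕ) : ℝ) := by positivity
    calc f m ^ q ≤ (K / ((n + 1 : ℕ) : ℝ)) ^ q :=
          Real.rpow_le_rpow (hf m) ((le_div_iff₀ hpos).2 hmK) hq
      _ = K ^ q * (((n + 1 : ℕ) : ℝ) ^ q)⁻¹ := by
          rw [Real.div_rpow hK hpos.le, div_eq_mul_inv]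

/-- A finite set of positive integers has a Schreier subset with at least half as many elements. -/
theorem exists_isSchreierSet_subset (S : Finset ℕ+) :
    ∃ F ⊆ S, IsSchreierSet F ∧ S.card ≤ 2 * F.card := by
  -- Here k = ⌈|S|/2⌉. At most k - 1 elements of S lie below k, so at least k elements are ≥ k, and
  -- any k of them form a Schreier set.
  set k := (S.card + 1) / 2 with hk
  have hlow : (S.filter fun n : ℕ+ => (n : ℕ) < k).card ≤ k - 1 := by
    calc (S.filter fun n : ℕ+ => (n : ℕ) < k).card
        = ((S.filter fun n : ℕ+ => (n : ℕ) < k).image fun n : ℕ+ => (n : ℕ)).card :=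
          (Finset.card_image_of_injective _ PNat.coe_injective).symm
      _ ≤ (Finset.Ico 1 k).card := by
          refine Finset.card_le_card fun a ha => ?_
          simp only [Finset.mem_image, Finset.mem_filter] at ha
          obtain ⟨n, ⟨-, hn⟩, rfl⟩ := ha
          exact Finset.mem_Ico.2 ⟨n.pos, hn⟩
      _ = k - 1 := by simp
  have hsum := Finset.card_filter_add_card_filter_not (s := S) (fun n : ℕ+ => (n : ℕ) < k)
  obtain ⟨F, hFS, hF⟩ := Finset.exists_subset_card_eq
    (s := S.filter fun n : ℕ+ => ¬ (n : ℕ) < k) (n := k) (by omega)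
  refine ⟨F, hFS.trans (Finset.filter_subset _ _), fun n hn => ?_, by omega⟩
  have := (Finset.mem_filter.1 (hFS hn)).2
  omega

namespace IsSchreierChain

theorem pairwiseDisjoint {C : Finset (Finset ℕ+)} (hC : IsSchreierChain C) :
    (C : Set (Finset ℕ+)).PairwiseDisjoint id := by
  intro F hF G hG hFG
  refine Finset.disjoint_left.2 fun n hnF hnG => ?_
  rcases hC.consecutive F hF G hG hFG with h | h <;> exact lt_irrefl _ (h n hnF n hnG)

theorem singleton {F : Finset ℕ+} (hne : F.Nonempty) (hF : IsSchreierSet F) :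
    IsSchreierChain {F} := by
  constructor <;> simp_all

end IsSchreierChain

/-! ### The Baernstein norm in real terms, and the inclusion of B_p in ℓ_q. -/

section Norm

variable {𝕜 : Type*} [RCLike 𝕜]

theorem baernsteinBeta_eq_ofReal {p : ℝ} (hp : 0 ≤ p) (x : ℕ+ → 𝕜) (C : Finset (Finset ℕ+)) :
    baernsteinBeta p x C =
      ENNReal.ofReal ((∑ F ∈ C, (∑ n ∈ F, ‖x n‖) ^ p) ^ (1 / p)) := by
  have hF : ∀ F : Finset ℕ+, (0 : ℝ) ≤ ∑ n ∈ F, ‖x n‖ := fun F =>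
    Finset.sum_nonneg fun _ _ => norm_nonneg _
  rw [baernsteinBeta, ← ENNReal.ofReal_rpow_of_nonneg
    (Finset.sum_nonneg fun F _ => Real.rpow_nonneg (hF F) p) (by positivity),
    ENNReal.ofReal_sum_of_nonneg fun F _ => Real.rpow_nonneg (hF F) p]
  congr 1
  refine Finset.sum_congr rfl fun F _ => ?_
  rw [← ENNReal.ofReal_rpow_of_nonneg (hF F) hp,
    ENNReal.ofReal_sum_of_nonneg fun _ _ => norm_nonneg _]
  simp only [ofReal_norm]

theorem baernsteinENorm_le_ofReal {p : ℝ} (hp : 0 < p) {x : ℕ+ → 𝕜} {K : ℝ} (hK : 0 ≤ K)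
    (h : ∀ C, IsSchreierChain C → ∑ F ∈ C, (∑ n ∈ F, ‖x n‖) ^ p ≤ K ^ p) :
    baernsteinENorm p x ≤ ENNReal.ofReal K := by
  refine iSup₂_le fun C hC => ?_
  rw [baernsteinBeta_eq_ofReal hp.le]
  refine ENNReal.ofReal_le_ofReal ?_
  rw [one_div]
  refine (Real.rpow_inv_le_iff_of_pos ?_ hK hp).2 (h C hC)
  exact Finset.sum_nonneg fun F _ => Real.rpow_nonneg
    (Finset.sum_nonneg fun _ _ => norm_nonneg _) p

end Norm

namespace Baernstein

variable {𝕜 : Type*} [RCLike 𝕜] {p : ℝ} [hp : Fact (1 < p)]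

/-- An element of `B_p` as a scalar sequence. -/
def toSeq : Baernstein 𝕜 p →ₗ[𝕜] (ℕ+ → 𝕜) where
  toFun x := x.1
  map_add' _ _ := rfl
  map_smul' _ _ := rfl

@[simp] theorem toSeq_apply (x : Baernstein 𝕜 p) (n : ℕ+) : toSeq x n = x n := rfl

theorem toSeq_injective : Function.Injective (toSeq : Baernstein 𝕜 p →ₗ[𝕜] (ℕ+ → 𝕜)) :=
  Subtype.val_injective

theorem sum_rpow_le_norm_rpow (x : Baernstein 𝕜 p) {C : Finset (Finset ℕ+)}
    (hC : IsSchreierChain C) : ∑ F ∈ C, (∑ n ∈ F, ‖x n‖) ^ p ≤ ‖x‖ ^ p := by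
  have hp0 : 0 < p := one_pos.trans hp.out
  have h0 : 0 ≤ ∑ F ∈ C, (∑ n ∈ F, ‖x n‖) ^ p := Finset.sum_nonneg fun F _ =>
    Real.rpow_nonneg (Finset.sum_nonneg fun _ _ => norm_nonneg _) p
  rw [← Real.rpow_inv_le_iff_of_pos h0 (norm_nonneg x) hp0, ← one_div]
  have h := ENNReal.toReal_mono (ne_of_lt x.2) (baernsteinBeta_le_eNorm p x.1 hC)
  rwa [baernsteinBeta_eq_ofReal hp0.le, ENNReal.toReal_ofReal (Real.rpow_nonneg h0 _)] at h

theorem sum_norm_le_norm (x : Baernstein 𝕜 p) {F : Finset ℕ+} (hF : IsSchreierSet F) :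
    ∑ n ∈ F, ‖x n‖ ≤ ‖x‖ := by
  rcases F.eq_empty_or_nonempty with rfl | hne
  · simp
  have h := sum_rpow_le_norm_rpow x (IsSchreierChain.singleton hne hF)
  rw [Finset.sum_singleton] at h
  exact (Real.rpow_le_rpow_iff (Finset.sum_nonneg fun _ _ => norm_nonneg _) (norm_nonneg x)
    (one_pos.trans hp.out)).1 h

/-- The element of `B_p` given by a sequence satisfying a uniform bound over Schreier chains. -/
def ofSeq (x : ℕ+ → 𝕜) {K : ℝ} (hK : 0 ≤ K)
    (h : ∀ C, IsSchreierChain C → ∑ F ∈ C, (∑ n ∈ F, ‖x n‖) ^ p ≤ K ^ p) : Baernstein 𝕜 p :=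
  ⟨x, (baernsteinENorm_le_ofReal (one_pos.trans hp.out) hK h).trans_lt ENNReal.ofReal_lt_top⟩

theorem norm_ofSeq_le (x : ℕ+ → 𝕜) {K : ℝ} (hK : 0 ≤ K)
    (h : ∀ C, IsSchreierChain C → ∑ F ∈ C, (∑ n ∈ F, ‖x n‖) ^ p ≤ K ^ p) :
    ‖(ofSeq x hK h : Baernstein 𝕜 p)‖ ≤ K :=
  ENNReal.toReal_le_of_le_ofReal hK (baernsteinENorm_le_ofReal (one_pos.trans hp.out) hK h)

/-- The minimum over S is at most the mean over a Schreier subset of half the size. This is the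
weak-ℓ_1 estimate. -/
theorem exists_norm_mul_card_le (x : Baernstein 𝕜 p) {S : Finset ℕ+} (hS : S.Nonempty) :
    ∃ m ∈ S, ‖x m‖ * S.card ≤ 2 * ‖x‖ := by
  obtain ⟨m, hm, hmin⟩ := S.exists_min_image (fun n => ‖x n‖) hS
  obtain ⟨F, hFS, hF, hcard⟩ := exists_isSchreierSet_subset S
  refine ⟨m, hm, ?_⟩
  have h1 : F.card • ‖x m‖ ≤ ∑ n ∈ F, ‖x n‖ :=
    Finset.card_nsmul_le_sum _ _ _ fun n hn => hmin n (hFS hn)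
  have h2 := h1.trans (sum_norm_le_norm x hF)
  rw [nsmul_eq_mul] at h2
  have h3 : (S.card : ℝ) ≤ 2 * F.card := by exact_mod_cast hcard
  nlinarith [norm_nonneg (x m)]

/-- `B_p` is contained in `ℓ_q` for every `q > 1`. -/
theorem exists_sum_rpow_le {q : ℝ} (hq : 1 < q) :
    ∃ K : ℝ, 0 < K ∧ ∀ (x : Baernstein 𝕜 p) (S : Finset ℕ+),
      ∑ n ∈ S, ‖x n‖ ^ q ≤ (K * ‖x‖) ^ q := by
  have hq0 : 0 < q := one_pos.trans hq
  have hsum : Summable fun j : ℕ => (((j + 1 : ℕ) : ℝ) ^ q)⁻¹ :=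
    (summable_nat_add_iff 1).2 (Real.summable_nat_rpow_inv.2 hq)
  set Z := ∑' j : ℕ, (((j + 1 : ℕ) : ℝ) ^ q)⁻¹ with hZ
  have hZ0 : 0 < Z := hsum.tsum_pos (fun j => by positivity) 0 (by norm_num)
  refine ⟨2 * Z ^ q⁻¹, by positivity, fun x S => ?_⟩
  calc ∑ n ∈ S, ‖x n‖ ^ q
      ≤ (2 * ‖x‖) ^ q * ∑ j ∈ Finset.range S.card, (((j + 1 : ℕ) : ℝ) ^ q)⁻¹ :=
        sum_rpow_le_of_exists_mul_card_le (fun n => norm_nonneg _) (by positivity) hq0.le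
          (fun S hS => exists_norm_mul_card_le x hS) S
    _ ≤ (2 * ‖x‖) ^ q * Z := by
        gcongr
        exact hsum.sum_le_tsum _ fun j _ => by positivity
    _ = (2 * Z ^ q⁻¹ * ‖x‖) ^ q := by
        rw [mul_right_comm, Real.mul_rpow (by positivity : 0 ≤ 2 * ‖x‖) (by positivity),
          Real.rpow_inv_rpow hZ0.le hq0.ne']

end Baernstein

/-- A linear map into the space of scalar sequences whose values satisfy a uniform `ℓ_q` bound
is a bounded operator into `ℓ_q`. -/
theorem exists_clm_lp_apply_eq {𝕜 E ι : Type*} [RCLike 𝕜] [NormedAddCommGroup E]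
    [NormedSpace 𝕜 E] {q : ℝ} [hq : Fact (1 < q)] (f : E →ₗ[𝕜] (ι → 𝕜)) {K : ℝ} (hK : 0 ≤ K)
    (h : ∀ x (s : Finset ι), ∑ i ∈ s, ‖f x i‖ ^ q ≤ (K * ‖x‖) ^ q) :
    ∃ R : E →L[𝕜] lp (fun _ : ι => 𝕜) (ENNReal.ofReal q), ∀ x i, R x i = f x i := by
  have hq0 : 0 < q := one_pos.trans hq.out
  have hqr : (ENNReal.ofReal q).toReal = q := ENNReal.toReal_ofReal hq0.le
  let L : E →ₗ[𝕜] lp (fun _ : ι => 𝕜) (ENNReal.ofReal q) :=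
    { toFun := fun x => ⟨f x, memℓp_gen' (C := (K * ‖x‖) ^ q) (by simpa only [hqr] using h x)⟩
      map_add' := fun x y => Subtype.ext (f.map_add x y)
      map_smul' := fun c x => Subtype.ext (f.map_smul c x) }
  refine ⟨L.mkContinuous K fun x => ?_, fun x i => rfl⟩
  refine lp.norm_le_of_forall_sum_le (by rwa [hqr]) (by positivity) fun s => ?_
  rw [hqr]
  exact h x s

/-! ### Dyadic blocks and the complemented copy of ℓ_q. -/

/-- The dyadic interval `[2 ^ k, 2 ^ (k + 1))` of positive integers. -/
def dyadicBlock (k : ℕ) : Finset ℕ+ := Finset.Ico (2 ^ k) (2 ^ (k + 1))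

theorem mem_dyadicBlock {k : ℕ} {n : ℕ+} : n ∈ dyadicBlock k ↔ Nat.log 2 n = k := by
  rw [Nat.log_eq_iff (Or.inr ⟨one_lt_two, n.ne_zero⟩), dyadicBlock, Finset.mem_Ico,
    ← PNat.coe_le_coe, ← PNat.coe_lt_coe]
  simp

theorem card_dyadicBlock (k : ℕ) : (dyadicBlock k).card = 2 ^ k := by
  simp [dyadicBlock, pow_succ, mul_two]

theorem dyadicBlock_nonempty (k : ℕ) : (dyadicBlock k).Nonempty :=
  Finset.card_pos.1 (by rw [card_dyadicBlock]; positivity)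

theorem isSchreierSet_dyadicBlock (k : ℕ) : IsSchreierSet (dyadicBlock k) := fun n hn => by
  rw [card_dyadicBlock, ← mem_dyadicBlock.1 hn]
  exact Nat.pow_log_le_self 2 n.ne_zero

theorem dyadicBlock_injective : Function.Injective dyadicBlock := fun k l h => by
  obtain ⟨n, hn⟩ := dyadicBlock_nonempty k
  exact (mem_dyadicBlock.1 hn).symm.trans (mem_dyadicBlock.1 (h ▸ hn))

theorem lt_of_mem_dyadicBlock {k l : ℕ} (hkl : k < l) {m n : ℕ+} (hm : m ∈ dyadicBlock k)
    (hn : n ∈ dyadicBlock l) : m < n := by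
  by_contra! h
  have := Nat.log_mono_right (b := 2) (PNat.coe_le_coe _ _ |>.2 h)
  rw [mem_dyadicBlock.1 hm, mem_dyadicBlock.1 hn] at this
  omega

theorem isSchreierChain_image_dyadicBlock {s : Finset ℕ} (hs : s.Nonempty) :
    IsSchreierChain (s.image dyadicBlock) where
  nonempty := hs.image _
  nonempty_of_mem F hF := by
    obtain ⟨k, -, rfl⟩ := Finset.mem_image.1 hF
    exact dyadicBlock_nonempty k
  isSchreierSet_of_mem F hF := by
    obtain ⟨k, -, rfl⟩ := Finset.mem_image.1 hF
    exact isSchreierSet_dyadicBlock k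
  consecutive F hF G hG hFG := by
    obtain ⟨k, -, rfl⟩ := Finset.mem_image.1 hF
    obtain ⟨l, -, rfl⟩ := Finset.mem_image.1 hG
    rcases lt_trichotomy k l with h | rfl | h
    · exact Or.inl fun m hm n hn => lt_of_mem_dyadicBlock h hm hn
    · exact absurd rfl hFG
    · exact Or.inr fun m hm n hn => lt_of_mem_dyadicBlock h hn hm

/-- The weight `2 ^ (-k)` of the elements of the `k`-th dyadic interval. -/
noncomputable def dyadicWeight (n : ℕ+) : ℝ := ((2 : ℝ) ^ Nat.log 2 n)⁻¹

theorem dyadicWeight_nonneg (n : ℕ+) : 0 ≤ dyadicWeight n := by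
  unfold dyadicWeight; positivity

theorem dyadicWeight_le (n : ℕ+) : dyadicWeight n ≤ 2 / (n : ℕ) := by
  have h : (n : ℕ) ≤ 2 ^ Nat.log 2 n * 2 := (Nat.lt_pow_succ_log_self one_lt_two n).le
  have h' : ((n : ℕ) : ℝ) ≤ 2 ^ Nat.log 2 n * 2 := by exact_mod_cast h
  have hn : (0 : ℝ) < ((n : ℕ) : ℝ) := by exact_mod_cast n.pos
  rw [dyadicWeight, inv_eq_one_div, div_le_div_iff₀ (by positivity) hn]
  linarith

/-- Each of the |F| weights is at most 2/n ≤ 2/|F|, since |F| ≤ n on F. -/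
theorem IsSchreierSet.sum_dyadicWeight_le {F : Finset ℕ+} (hF : IsSchreierSet F) :
    ∑ n ∈ F, dyadicWeight n ≤ 2 := by
  rcases F.eq_empty_or_nonempty with rfl | hne
  · simp
  have hc : (0 : ℝ) < F.card := by exact_mod_cast Finset.card_pos.2 hne
  calc ∑ n ∈ F, dyadicWeight n ≤ ∑ n ∈ F, 2 / (F.card : ℝ) := by
        refine Finset.sum_le_sum fun n hn => (dyadicWeight_le n).trans ?_
        have : (F.card : ℝ) ≤ (n : ℕ) := by exact_mod_cast hF n hn
        gcongr
    _ = 2 := by rw [Finset.sum_const, nsmul_eq_mul]; field_simp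

/-- The weights of a whole dyadic block add up to 1, so the part of B in block k contributes at most
f k. -/
theorem sum_dyadicWeight_mul_le {f : ℕ → ℝ} (hf : ∀ k, 0 ≤ f k) (B : Finset ℕ+) :
    ∑ n ∈ B, dyadicWeight n * f (Nat.log 2 n) ≤
      ∑ k ∈ B.image fun n : ℕ+ => Nat.log 2 n, f k := by
  rw [← Finset.sum_fiberwise_of_maps_to (s := B) (g := fun n : ℕ+ => Nat.log 2 n)
    fun n hn => Finset.mem_image_of_mem (fun n : ℕ+ => Nat.log 2 n) hn]
  refine Finset.sum_le_sum fun k _ => ?_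
  calc ∑ n ∈ B.filter fun n : ℕ+ => Nat.log 2 n = k, dyadicWeight n * f (Nat.log 2 n)
      = ∑ n ∈ B.filter fun n : ℕ+ => Nat.log 2 n = k, ((2 : ℝ) ^ k)⁻¹ * f k :=
        Finset.sum_congr rfl fun n hn => by rw [dyadicWeight, (Finset.mem_filter.1 hn).2]
    _ ≤ ∑ n ∈ dyadicBlock k, ((2 : ℝ) ^ k)⁻¹ * f k := by
        refine Finset.sum_le_sum_of_subset_of_nonneg (fun n hn => ?_) fun n _ _ =>
          mul_nonneg (by positivity) (hf k)
        exact mem_dyadicBlock.2 (Finset.mem_filter.1 hn).2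
    _ = f k := by
        rw [Finset.sum_const, card_dyadicBlock, nsmul_eq_mul]
        push_cast
        field_simp

/-- Schur-type estimate for the averaging vectors over the dyadic intervals. -/
theorem IsSchreierChain.sum_rpow_dyadicWeight_le {C : Finset (Finset ℕ+)}
    (hC : IsSchreierChain C) {q : ℝ} (hq : 1 < q) {f : ℕ → ℝ} (hf : ∀ k, 0 ≤ f k) {K : ℝ}
    (hK : 0 ≤ K) (h : ∀ s : Finset ℕ, ∑ k ∈ s, f k ^ q ≤ K ^ q) :
    ∑ F ∈ C, (∑ n ∈ F, dyadicWeight n * f (Nat.log 2 n)) ^ q ≤ (2 * K) ^ q := by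
  have hq0 : 0 < q := one_pos.trans hq
  have key : ∀ F ∈ C, (∑ n ∈ F, dyadicWeight n * f (Nat.log 2 n)) ^ q ≤
      2 ^ q * ∑ n ∈ F, dyadicWeight n * f (Nat.log 2 n) ^ q := by
    intro F hF
    have hw0 : 0 ≤ ∑ n ∈ F, dyadicWeight n := Finset.sum_nonneg fun n _ => dyadicWeight_nonneg n
    have hs0 : 0 ≤ ∑ n ∈ F, dyadicWeight n * f (Nat.log 2 n) ^ q := Finset.sum_nonneg fun n _ =>
      mul_nonneg (dyadicWeight_nonneg n) (Real.rpow_nonneg (hf _) q)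
    -- Weighted Hölder on F: the total weight enters to the power 1 - 1/q, and being at most 2 it
    -- costs at most a factor 2.
    have h1 := Real.inner_le_weight_mul_Lp_of_nonneg F hq.le dyadicWeight
      (fun n : ℕ+ => f (Nat.log 2 n)) dyadicWeight_nonneg fun n => hf _
    have h2 : (∑ n ∈ F, dyadicWeight n) ^ (1 - q⁻¹) ≤ 2 := by
      have hq1 : q⁻¹ ≤ 1 := inv_le_one_of_one_le₀ hq.le
      calc (∑ n ∈ F, dyadicWeight n) ^ (1 - q⁻¹) ≤ (2 : ℝ) ^ (1 - q⁻¹) :=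
            Real.rpow_le_rpow hw0 (hC.isSchreierSet_of_mem F hF).sum_dyadicWeight_le
              (by linarith)
        _ ≤ (2 : ℝ) ^ (1 : ℝ) := Real.rpow_le_rpow_of_exponent_le one_le_two
              (by linarith [inv_pos.2 hq0])
        _ = 2 := Real.rpow_one 2
    calc (∑ n ∈ F, dyadicWeight n * f (Nat.log 2 n)) ^ q
        ≤ (2 * (∑ n ∈ F, dyadicWeight n * f (Nat.log 2 n) ^ q) ^ q⁻¹) ^ q := by
          refine Real.rpow_le_rpow (Finset.sum_nonneg fun n _ =>
            mul_nonneg (dyadicWeight_nonneg n) (hf _)) (h1.trans ?_) hq0.le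
          gcongr
      _ = _ := by
          rw [Real.mul_rpow zero_le_two (Real.rpow_nonneg hs0 _),
            Real.rpow_inv_rpow hs0 hq0.ne']
  calc ∑ F ∈ C, (∑ n ∈ F, dyadicWeight n * f (Nat.log 2 n)) ^ q
      ≤ ∑ F ∈ C, 2 ^ q * ∑ n ∈ F, dyadicWeight n * f (Nat.log 2 n) ^ q := Finset.sum_le_sum key
    _ = 2 ^ q * ∑ n ∈ C.biUnion id, dyadicWeight n * f (Nat.log 2 n) ^ q := by
        rw [← Finset.mul_sum, Finset.sum_biUnion hC.pairwiseDisjoint]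
        rfl
    _ ≤ 2 ^ q * K ^ q := by
        gcongr
        exact (sum_dyadicWeight_mul_le (f := fun k => f k ^ q)
          (fun k => Real.rpow_nonneg (hf k) q) _).trans (h _)
    _ = (2 * K) ^ q := (Real.mul_rpow zero_le_two hK).symm

namespace Baernstein

variable {𝕜 : Type*} [RCLike 𝕜]

/-- The span of the averages over the dyadic intervals is a copy of `ℓ_q` in `B_q`. -/
theorem exists_clm_of_lp (q : ℝ) [hq : Fact (1 < q)] :
    ∃ V : lp (fun _ : ℕ+ => 𝕜) (ENNReal.ofReal q) →L[𝕜] Baernstein 𝕜 q,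
      ∀ a n, V a n = (dyadicWeight n : 𝕜) * a (Nat.log 2 n).succPNat := by
  have hq0 : 0 < q := one_pos.trans hq.out
  have hqr : (ENNReal.ofReal q).toReal = q := ENNReal.toReal_ofReal hq0.le
  have hb : ∀ (a : lp (fun _ : ℕ+ => 𝕜) (ENNReal.ofReal q)) (C : Finset (Finset ℕ+)),
      IsSchreierChain C →
      ∑ F ∈ C, (∑ n ∈ F, ‖(dyadicWeight n : 𝕜) * a (Nat.log 2 n).succPNat‖) ^ q ≤
        (2 * ‖a‖) ^ q := by
    intro a C hC
    have h := hC.sum_rpow_dyadicWeight_le hq.out (f := fun k => ‖a k.succPNat‖)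
      (fun k => norm_nonneg _) (norm_nonneg a) fun s => by
        have := lp.sum_rpow_le_norm_rpow (by rwa [hqr]) a
          (s.map ⟨Nat.succPNat, Nat.succPNat_injective⟩)
        rwa [hqr, Finset.sum_map] at this
    simpa only [norm_mul, RCLike.norm_ofReal, abs_of_nonneg (dyadicWeight_nonneg _)] using h
  let L : lp (fun _ : ℕ+ => 𝕜) (ENNReal.ofReal q) →ₗ[𝕜] Baernstein 𝕜 q :=
    { toFun := fun a => ofSeq _ (by positivity) (hb a)
      map_add' := fun a b => Subtype.ext (funext fun n => mul_add _ _ _)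
      map_smul' := fun c a => Subtype.ext (funext fun n => mul_left_comm _ _ _) }
  exact ⟨L.mkContinuous 2 fun a => norm_ofSeq_le _ (by positivity) (hb a), fun a n => rfl⟩

/-- Summation over the dyadic intervals is bounded from `B_q` to `ℓ_q`. -/
theorem exists_clm_to_lp (q : ℝ) [hq : Fact (1 < q)] :
    ∃ U : Baernstein 𝕜 q →L[𝕜] lp (fun _ : ℕ+ => 𝕜) (ENNReal.ofReal q),
      ∀ x j, U x j = ∑ n ∈ dyadicBlock j.natPred, x n := by
  have hq0 : 0 < q := one_pos.trans hq.out
  refine exists_clm_lp_apply_eq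
    (LinearMap.pi fun j : ℕ+ => ∑ n ∈ dyadicBlock j.natPred, LinearMap.proj n ∘ₗ toSeq)
    zero_le_one (fun x s => ?_) |>.imp fun U hU x j => ?_
  · rcases s.eq_empty_or_nonempty with rfl | hs
    · simpa using Real.rpow_nonneg (norm_nonneg x) q
    have h := sum_rpow_le_norm_rpow x (isSchreierChain_image_dyadicBlock (hs.image PNat.natPred))
    rw [Finset.sum_image dyadicBlock_injective.injOn,
      Finset.sum_image PNat.natPred_injective.injOn] at h
    rw [one_mul]
    refine le_trans (Finset.sum_le_sum fun j _ => Real.rpow_le_rpow (norm_nonneg _) ?_ hq0.le) h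
    simpa using norm_sum_le (dyadicBlock j.natPred) fun n => x n
  · simp [hU]

/-- `ℓ_q` embeds complementably in `B_q`. -/
theorem exists_comp_eq_id (q : ℝ) [hq : Fact (1 < q)] :
    ∃ (V : lp (fun _ : ℕ+ => 𝕜) (ENNReal.ofReal q) →L[𝕜] Baernstein 𝕜 q)
      (U : Baernstein 𝕜 q →L[𝕜] lp (fun _ : ℕ+ => 𝕜) (ENNReal.ofReal q)),
      U ∘L V = ContinuousLinearMap.id 𝕜 (lp (fun _ : ℕ+ => 𝕜) (ENNReal.ofReal q)) := by
  obtain ⟨V, hV⟩ := exists_clm_of_lp (𝕜 := 𝕜) q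
  obtain ⟨U, hU⟩ := exists_clm_to_lp (𝕜 := 𝕜) q
  refine ⟨V, U, ContinuousLinearMap.ext fun a => Subtype.ext (funext fun j => ?_)⟩
  have h : ∀ n ∈ dyadicBlock j.natPred, V a n = ((2 : 𝕜) ^ j.natPred)⁻¹ * a j := by
    intro n hn
    rw [hV, dyadicWeight, mem_dyadicBlock.1 hn, PNat.succPNat_natPred]
    push_cast
    rfl
  change U (V a) j = a j
  rw [hU, Finset.sum_congr rfl h, Finset.sum_const, card_dyadicBlock, nsmul_eq_mul]
  push_cast
  rw [mul_inv_cancel_left₀ (pow_ne_zero _ two_ne_zero)]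

/-! ### Boundedness and non-compactness of the formal inclusion. -/

/-- The formal inclusion of `B_p` in `ℓ_q`. -/
theorem exists_formalInclusion (p q : ℝ) [hp : Fact (1 < p)] [hq : Fact (1 < q)] :
    ∃ R : Baernstein 𝕜 p →L[𝕜] lp (fun _ : ℕ+ => 𝕜) (ENNReal.ofReal q),
      ∀ (x : Baernstein 𝕜 p) (n : ℕ+), R x n = x n := by
  obtain ⟨K, hK, h⟩ := exists_sum_rpow_le (𝕜 := 𝕜) (p := p) hq.out
  exact exists_clm_lp_apply_eq (toSeq (𝕜 := 𝕜) (p := p)) hK.le h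

variable {p : ℝ} [hp : Fact (1 < p)]

/-- The unit vectors are in the unit ball of `B_p`. -/
theorem exists_eq_single (k : ℕ+) :
    ∃ e : Baernstein 𝕜 p, ‖e‖ ≤ 1 ∧ ∀ n, e n = if n = k then 1 else 0 := by
  have hp0 : 0 < p := one_pos.trans hp.out
  have h : ∀ C, IsSchreierChain C →
      ∑ F ∈ C, (∑ n ∈ F, ‖if n = k then (1 : 𝕜) else 0‖) ^ p ≤ 1 ^ p := by
    intro C hC
    have h1 : ∀ F : Finset ℕ+, (∑ n ∈ F, ‖if n = k then (1 : 𝕜) else 0‖) ^ p =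
        if k ∈ F then 1 else 0 := by
      intro F
      simp only [apply_ite norm, norm_one, norm_zero, Finset.sum_ite_eq']
      split_ifs <;> simp [hp0.ne']
    simp only [h1, Finset.sum_boole, Real.one_rpow]
    have : (C.filter fun F => k ∈ F).card ≤ 1 := by
      refine Finset.card_le_one.2 fun F hF G hG => ?_
      rw [Finset.mem_filter] at hF hG
      by_contra hne
      exact Finset.disjoint_left.1 (hC.pairwiseDisjoint hF.1 hG.1 hne) hF.2 hG.2
    exact_mod_cast this
  exact ⟨ofSeq _ zero_le_one h, norm_ofSeq_le _ _ _, fun n => rfl⟩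

theorem not_isCompactOperator_formalInclusion {q : ℝ} [hq : Fact (1 < q)]
    {R : Baernstein 𝕜 p →L[𝕜] lp (fun _ : ℕ+ => 𝕜) (ENNReal.ofReal q)}
    (hR : ∀ (x : Baernstein 𝕜 p) (n : ℕ+), R x n = x n) : ¬ IsCompactOperator R := by
  intro hc
  have hq0 : 0 < q := one_pos.trans hq.out
  choose e he1 he using fun k : ℕ+ => exists_eq_single (𝕜 := 𝕜) (p := p) k
  obtain ⟨K, hK, hsub⟩ := IsCompactOperator.image_closedBall_subset_compact
    (f := (R : Baernstein 𝕜 p →ₗ[𝕜] lp (fun _ : ℕ+ => 𝕜) (ENNReal.ofReal q))) hc 1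
  obtain ⟨a, -, φ, hφ, hlim⟩ := hK.tendsto_subseq (x := fun n : ℕ => R (e n.succPNat))
    fun n => hsub ⟨_, by simpa using he1 _, rfl⟩
  obtain ⟨N, hN⟩ := Metric.cauchySeq_iff.1 hlim.cauchySeq 1 one_pos
  have h := hN N le_rfl (N + 1) (by omega)
  refine absurd h (not_lt.2 ?_)
  rw [dist_eq_norm]
  -- The images of distinct unit vectors are at distance at least 1, as one coordinate of their
  -- difference equals 1; so no subsequence is Cauchy.
  refine le_trans (le_of_eq ?_) (lp.norm_apply_le_norm (by simpa using hq0) _ (φ N).succPNat)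
  have hne : φ N ≠ φ (N + 1) := (hφ (Nat.lt_succ_self N)).ne
  rw [lp.coeFn_sub, Pi.sub_apply]
  simp only [Function.comp_apply, hR, he]
  rw [if_pos trivial, if_neg fun h => hne (Nat.succPNat_injective h)]
  simp

end Baernstein

/-! ### Gliding hump and strict singularity. -/

namespace Baernstein

variable {𝕜 : Type*} [RCLike 𝕜] {p : ℝ} [hp : Fact (1 < p)]

theorem finite_setOf_le_norm (x : Baernstein 𝕜 p) {ε : ℝ} (hε : 0 < ε) :
    {n | ε ≤ ‖x n‖}.Finite := by
  by_contra hinf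
  obtain ⟨N, hN⟩ := exists_nat_gt (2 * ‖x‖ / ε)
  obtain ⟨S, hS, hcard⟩ := Set.Infinite.exists_subset_card_eq hinf (N + 1)
  obtain ⟨m, hm, hmS⟩ := exists_norm_mul_card_le x (S := S) (Finset.card_pos.1 (by omega))
  have hm' : ε ≤ ‖x m‖ := hS hm
  rw [hcard] at hmS
  rw [div_lt_iff₀ hε] at hN
  push_cast at hmS
  nlinarith [norm_nonneg (x m), (Nat.cast_nonneg N : (0 : ℝ) ≤ N)]

theorem exists_forall_norm_le {x : Baernstein 𝕜 p} (hx : x ≠ 0) :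
    ∃ m, x m ≠ 0 ∧ ∀ n, ‖x n‖ ≤ ‖x m‖ := by
  obtain ⟨k, hk⟩ : ∃ k, x k ≠ 0 := by
    by_contra! h
    exact hx (toSeq_injective (funext h))
  obtain ⟨m, hm, hmax⟩ := Set.exists_max_image _ (fun n => ‖x n‖)
    (finite_setOf_le_norm x (norm_pos_iff.2 hk)) ⟨k, le_refl ‖x k‖⟩
  have hm : ‖x k‖ ≤ ‖x m‖ := hm
  refine ⟨m, norm_pos_iff.1 ((norm_pos_iff.2 hk).trans_le hm), fun n => ?_⟩
  rcases le_total ‖x k‖ ‖x n‖ with h | h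
  · exact hmax n h
  · exact h.trans hm

/-- An infinite-dimensional subspace contains a vector of sup norm one, attained, which vanishes
on a given finite set of coordinates. -/
theorem exists_mem_eq_one {W : Submodule 𝕜 (Baernstein 𝕜 p)} (hW : ¬ FiniteDimensional 𝕜 W)
    (S : Finset ℕ+) :
    ∃ x ∈ W, (∀ n ∈ S, x n = 0) ∧ (∀ n, ‖x n‖ ≤ 1) ∧ ∃ m, x m = 1 := by
  let f : W →ₗ[𝕜] (S → 𝕜) := LinearMap.pi fun n => LinearMap.proj n.1 ∘ₗ toSeq ∘ₗ W.subtype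
  -- Finitely many coordinates cannot separate the points of W, so some non-zero vector of W
  -- vanishes on S.
  have hf : ¬ Function.Injective f := fun h => hW (Module.Finite.of_injective f h)
  rw [← LinearMap.ker_eq_bot, Submodule.eq_bot_iff] at hf
  push Not at hf
  obtain ⟨x, hxf, hx0⟩ := hf
  obtain ⟨m, hm0, hm⟩ := exists_forall_norm_le (x := x.1) fun h => hx0 (Subtype.ext h)
  have hsmul : ∀ n, ((x.1 m)⁻¹ • x.1 : Baernstein 𝕜 p) n = (x.1 m)⁻¹ * x.1 n := fun n => rfl
  refine ⟨(x.1 m)⁻¹ • x.1, W.smul_mem _ x.2, fun n hn => ?_, fun n => ?_, m, ?_⟩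
  · have : f x ⟨n, hn⟩ = 0 := by rw [LinearMap.mem_ker.1 hxf]; rfl
    have : x.1 n = 0 := this
    rw [hsmul, this, mul_zero]
  · rw [hsmul, norm_mul, norm_inv]
    exact inv_mul_le_one_of_le₀ (hm n) (norm_nonneg _)
  · rw [hsmul, inv_mul_cancel₀ hm0]

/-- Gliding hump: an infinite-dimensional subspace contains vectors of bounded sup norm which
are large on many coordinates far out. -/
theorem exists_mem_half_le {W : Submodule 𝕜 (Baernstein 𝕜 p)} (hW : ¬ FiniteDimensional 𝕜 W)
    (M : ℕ+) (k : ℕ) :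
    ∃ y ∈ W, (∀ n < M, y n = 0) ∧ (∀ n, ‖y n‖ ≤ 3 / 2) ∧
      ∃ A : Finset ℕ+, A.card = k ∧ ∀ n ∈ A, 1 / 2 ≤ ‖y n‖ := by
  induction k with
  | zero =>
    have h0 : ∀ n, (0 : Baernstein 𝕜 p) n = 0 := fun n => rfl
    exact ⟨0, W.zero_mem, fun n _ => h0 n, fun n => by rw [h0]; norm_num, ∅, rfl, by simp⟩
  | succ k ih =>
    obtain ⟨y, hyW, hyM, hy, A, hA, hyA⟩ := ih
    have hfin := finite_setOf_le_norm y (one_half_pos (α := ℝ))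
    -- The new vector x vanishes wherever |y| ≥ 1/2. Off S the sum is at most 1/2 + 1, and at the
    -- new peak m it is at least 1 - 1/2, so both bounds survive the induction.
    set S := hfin.toFinset ∪ Finset.Iio M with hS
    obtain ⟨x, hxW, hxS, hx, m, hm⟩ := exists_mem_eq_one hW S
    have hadd : ∀ n, (y + x : Baernstein 𝕜 p) n = y n + x n := fun n => rfl
    have hsmall : ∀ n ∉ S, ‖y n‖ < 1 / 2 := fun n hn => by
      by_contra! h
      exact hn (Finset.mem_union_left _ (by simpa using h))
    have hmS : m ∉ S := fun h => by
      rw [hxS m h] at hm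
      exact zero_ne_one hm
    have hAS : ∀ n ∈ A, n ∈ S := fun n hn =>
      Finset.mem_union_left _ (by simpa using hyA n hn)
    have hmA : m ∉ A := fun h => hmS (hAS m h)
    refine ⟨y + x, W.add_mem hyW hxW, fun n hn => ?_, fun n => ?_, insert m A, ?_, fun n hn => ?_⟩
    · rw [hadd, hyM n hn, hxS n (Finset.mem_union_right _ (Finset.mem_Iio.2 hn)), add_zero]
    · rw [hadd]
      by_cases hn : n ∈ S
      · rw [hxS n hn, add_zero]
        exact hy n
      · linarith [norm_add_le (y n) (x n), hsmall n hn, hx n]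
    · rw [Finset.card_insert_of_notMem hmA, hA]
    · rw [hadd]
      rcases Finset.mem_insert.1 hn with rfl | hn
      · have h1 := norm_sub_le (y n + x n) (y n)
        rw [add_sub_cancel_left, hm, norm_one] at h1
        rw [hm]
        linarith [hsmall n hmS]
      · rw [hxS n (hAS n hn), add_zero]
        exact hyA n hn

/-- In an infinite-dimensional subspace of `B_p`, the norm is not dominated by the sup norm. -/
theorem exists_mem_lt_norm {W : Submodule 𝕜 (Baernstein 𝕜 p)} (hW : ¬ FiniteDimensional 𝕜 W)
    (K : ℝ) : ∃ y ∈ W, (∀ n, ‖y n‖ ≤ 3 / 2) ∧ K < ‖y‖ := by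
  obtain ⟨N, hN⟩ := exists_nat_gt (2 * K)
  -- `N.succPNat` is N + 1, so A has N + 1 elements, all at least N + 1: it is Schreier, and its sum
  -- is at least (N + 1)/2 > K.
  obtain ⟨y, hyW, hyM, hy, A, hA, hyA⟩ := exists_mem_half_le hW N.succPNat (N + 1)
  have hAS : IsSchreierSet A := by
    intro n hn
    rw [hA]
    by_contra! h
    have h0 := hyA n hn
    rw [hyM n ((PNat.coe_lt_coe _ _).1 (by simpa using h)), norm_zero] at h0
    norm_num at h0
  refine ⟨y, hyW, hy, ?_⟩
  have h1 := Finset.card_nsmul_le_sum A (fun n => ‖y n‖) (1 / 2) hyA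
  have h2 := h1.trans (sum_norm_le_norm y hAS)
  rw [hA, nsmul_eq_mul] at h2
  push_cast at h2
  linarith

/-- Interpolation between the sup norm and the norm of `B_p`. -/
theorem exists_sum_rpow_le_mul {q : ℝ} (hq : 1 < q) :
    ∃ r K : ℝ, 0 < r ∧ r < q ∧ 0 < K ∧ ∀ (x : Baernstein 𝕜 p) (s : ℝ), (∀ n, ‖x n‖ ≤ s) →
      ∀ S : Finset ℕ+, ∑ n ∈ S, ‖x n‖ ^ q ≤ s ^ (q - r) * (K * ‖x‖) ^ r := by
  obtain ⟨r, hr1, hrq⟩ := exists_between hq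
  obtain ⟨K, hK, h⟩ := exists_sum_rpow_le (𝕜 := 𝕜) (p := p) hr1
  refine ⟨r, K, one_pos.trans hr1, hrq, hK, fun x s hs S => ?_⟩
  have hs0 : 0 ≤ s := (norm_nonneg _).trans (hs 1)
  -- Split off q - r powers for the sup norm; r was taken above 1 so that the ℓ_r bound applies to
  -- the rest.
  calc ∑ n ∈ S, ‖x n‖ ^ q ≤ ∑ n ∈ S, s ^ (q - r) * ‖x n‖ ^ r := by
        refine Finset.sum_le_sum fun n _ => ?_
        have : ‖x n‖ ^ q = ‖x n‖ ^ (q - r) * ‖x n‖ ^ r := by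
          rw [← Real.rpow_add_of_nonneg (norm_nonneg _) (by linarith) (by linarith)]
          congr 1; ring
        rw [this]
        have := hs n
        have : 0 ≤ q - r := by linarith
        gcongr
    _ ≤ s ^ (q - r) * (K * ‖x‖) ^ r := by
        rw [← Finset.mul_sum]
        exact mul_le_mul_of_nonneg_left (h x S) (Real.rpow_nonneg hs0 _)

theorem isStrictlySingular_formalInclusion {q : ℝ} [hq : Fact (1 < q)]
    {R : Baernstein 𝕜 p →L[𝕜] lp (fun _ : ℕ+ => 𝕜) (ENNReal.ofReal q)}
    (hR : ∀ (x : Baernstein 𝕜 p) (n : ℕ+), R x n = x n) : IsStrictlySingular R := by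
  rintro W hW ⟨c, hc, hcW⟩
  have hq0 : 0 < q := one_pos.trans hq.out
  have hqr : (ENNReal.ofReal q).toReal = q := ENNReal.toReal_ofReal hq0.le
  obtain ⟨r, K, hr0, hrq, hK, h⟩ := exists_sum_rpow_le_mul (𝕜 := 𝕜) (p := p) hq.out
  have hd : 0 < q - r := by linarith
  -- D is the bound on ‖y‖^(q-r) obtained by combining the lower bound c‖y‖ ≤ ‖R y‖ with
  -- interpolation at sup norm 3/2.
  set D : ℝ := (3 / 2) ^ (q - r) * K ^ r / c ^ q with hD
  obtain ⟨y, hyW, hy, hlt⟩ := exists_mem_lt_norm hW (D ^ (q - r)⁻¹)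
  have hD0 : 0 ≤ D := by positivity
  have hy0 : 0 < ‖y‖ := (Real.rpow_nonneg hD0 _).trans_lt hlt
  have h1 : ‖R y‖ ^ q ≤ (3 / 2) ^ (q - r) * (K * ‖y‖) ^ r := by
    have := lp.norm_rpow_eq_tsum (by rwa [hqr]) (R y)
    rw [hqr] at this
    rw [this]
    refine Real.tsum_le_of_sum_le (fun n => Real.rpow_nonneg (norm_nonneg _) q) fun S => ?_
    simp only [hR]
    exact h y (3 / 2) hy S
  have h2 : (c * ‖y‖) ^ q ≤ ‖R y‖ ^ q :=
    Real.rpow_le_rpow (by positivity) (hcW y hyW) hq0.le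
  have h3 : ‖y‖ ^ (q - r) ≤ D := by
    have := h2.trans h1
    rw [Real.mul_rpow hc.le hy0.le, Real.mul_rpow hK.le hy0.le] at this
    rw [hD, le_div_iff₀ (by positivity), Real.rpow_sub hy0, div_mul_eq_mul_div,
      div_le_iff₀ (by positivity)]
    linarith
  have h4 := Real.rpow_lt_rpow (Real.rpow_nonneg hD0 _) hlt hd
  rw [Real.rpow_inv_rpow hD0 hd.ne'] at h4
  linarith

end Baernstein

/-! ### Passing from R to VR. -/

theorem IsStrictlySingular.clm_comp {𝕜 E F G : Type*} [RCLike 𝕜] [NormedAddCommGroup E]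
    [NormedSpace 𝕜 E] [NormedAddCommGroup F] [NormedSpace 𝕜 F] [NormedAddCommGroup G]
    [NormedSpace 𝕜 G] {T : E →L[𝕜] F} (hT : IsStrictlySingular T) (S : F →L[𝕜] G) :
    IsStrictlySingular (S ∘L T) := by
  rintro W hW ⟨c, hc, h⟩
  refine hT W hW ⟨c / (‖S‖ + 1), by positivity, fun x hx => ?_⟩
  rw [div_mul_eq_mul_div, div_le_iff₀ (by positivity)]
  calc c * ‖x‖ ≤ ‖S (T x)‖ := h x hx
    _ ≤ ‖S‖ * ‖T x‖ := S.le_opNorm _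
    _ ≤ ‖T x‖ * (‖S‖ + 1) := by nlinarith [norm_nonneg (T x)]

theorem mainTheorem2 {𝕜 : Type*} [RCLike 𝕜] (p q : ℝ) [Fact (1 < p)] [Fact (1 < q)] :
    (∃ T : Baernstein 𝕜 p →L[𝕜] Baernstein 𝕜 q,
      IsStrictlySingular T ∧ ¬ IsCompactOperator T ∧
      ∃ (R : Baernstein 𝕜 p →L[𝕜] lp (fun _ : ℕ+ => 𝕜) (ENNReal.ofReal q))
        (V : lp (fun _ : ℕ+ => 𝕜) (ENNReal.ofReal q) →L[𝕜] Baernstein 𝕜 q)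
        (U : Baernstein 𝕜 q →L[𝕜] lp (fun _ : ℕ+ => 𝕜) (ENNReal.ofReal q)),
        (∀ (x : Baernstein 𝕜 p) (n : ℕ+), R x n = x n) ∧
        U ∘L V = ContinuousLinearMap.id 𝕜 (lp (fun _ : ℕ+ => 𝕜) (ENNReal.ofReal q)) ∧
        T = V ∘L R) ∧
    (q < p → ¬ ∀ T : Baernstein 𝕜 p →L[𝕜] Baernstein 𝕜 q, IsCompactOperator T) := by
  obtain ⟨R, hR⟩ := Baernstein.exists_formalInclusion (𝕜 := 𝕜) p q
  obtain ⟨V, U, hUV⟩ := Baernstein.exists_comp_eq_id (𝕜 := 𝕜) q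
  have hT : ¬ IsCompactOperator (V ∘L R) := fun hc => by
    refine Baernstein.not_isCompactOperator_formalInclusion hR ?_
    have h : R = U ∘L (V ∘L R) := by
      rw [← ContinuousLinearMap.comp_assoc, hUV, ContinuousLinearMap.id_comp]
    rw [h]
    exact hc.clm_comp U
  exact ⟨⟨V ∘L R, (Baernstein.isStrictlySingular_formalInclusion hR).clm_comp V, hT,
    R, V, U, hR, hUV, rfl⟩, fun _ h => hT (h _)⟩
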